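/- Let $\mathcal H$ and $\mathcal G$ be real Hilbert spaces and let $L\colon\mathcal H\to\mathcal G$ be a bounded linear operator with adjoint $L^*$ and $0<\|L\|\le 1$. Notation. For a real Hilbert space $\mathcal K$, $\Gamma_0(\mathcal K)$ is the class of proper lower semicontinuous convex functions from $\mathcal K$ to $]-\infty,+\infty]$ (proper: not identically $+\infty$), $\mathscr Q_{\mathcal K}=\|\cdot\|^2/2$, and $f^*(u)=\sup_{x\in\mathcal K}(\langle x,u\rangle-f(x))$ is the conjugate of $f\colon\mathcal K\to[-\infty,+\infty]$. The infimal convolution of $f,h\colon\mathcal K\to\,]-\infty,+\infty]$ is $(f\,\square\,h)(x)=\inf_{z\in\mathcal K}(f(z)+h(x-z))$. The subdifferential of a proper $f$ is the set-valued operator $\partial f(x)=\{u\in\mathcal K:\ \langle z-x,u\rangle+f(x)\le f(z)\ \text{for all }z\in\mathcal K\}$. If, for every $x\in\mathcal K$, the function $z\mapsto f(z)+\frac12\|x-z\|^2$ has exactly one global minimizer, the proximity operator of $f$ is said to be well defined, and $\mathrm{prox}_f(x)$ denotes that minimizer. The inverse of a set-valued operator $A$ is the operator $A^{-1}$ given by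 $x\in A^{-1}(y)\Leftrightarrow y\in A(x)$. For a set-valued operator $B\colon\mathcal G\to 2^{\mathcal G}$, the resolvent composition of $B$ with $L$ is $$L\triangleright B=\bigl(L^*\circ(B+\mathrm{Id}_{\mathcal G})^{-1}\circ L\bigr)^{-1}-\mathrm{Id}_{\mathcal H}\colon\mathcal H\to 2^{\mathcal H},$$ and for a proper function $g\colon\mathcal G\to\,]-\infty,+\infty]$, the proximal composition of $g$ with $L$ is $$L\triangleright g=\bigl((g^*\,\square\,\mathscr Q_{\mathcal G})\circ L\bigr)^*-\mathscr Q_{\mathcal H}.$$ Statement. Let $g\colon\mathcal G\to\,]-\infty,+\infty]$ be a proper function that admits a continuous affine minorant. Then: 1. $g^*\in\Gamma_0(\mathcal G)$. 2. $L\triangleright g\in\Gamma_0(\mathcal H)$. 3. $L\triangleright\partial g^{**}=\partial(L\triangleright g)$. 4. The proximity operators of $L\triangleright g$ and $g^{**}$ are well defined, and $\mathrm{prox}_{L\triangleright g}=L^*\circ\mathrm{prox}_{g^{**}}\circ L$. In particular, for every $g\in\Gamma_0(\mathcal G)$: 5. $L\triangleright\partial g=\partial(L\triangleright g)$. 6.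 The proximity operators of $L\triangleright g$ and $g$ are well defined, and $\mathrm{prox}_{L\triangleright g}=L^*\circ\mathrm{prox}_g\circ L$. -/

import Mathlib

noncomputable section

namespace ProximalComposition

universe u v

/-! ### Set-valued operators

A set-valued operator from `X` to `2^Y` is a function `X → Set Y`. -/

section Operators

variable {H : Type u} [NormedAddCommGroup H] [InnerProductSpace ℝ H] [CompleteSpace H]
variable {G : Type v} [NormedAddCommGroup G] [InnerProductSpace ℝ G] [CompleteSpace G]

/-- The inverse `A⁻¹` of a set-valued operator. -/
def opInv {X : Type u} {Y : Type v} (A : X → Set Y) : Y → Set X :=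
  fun y => {x | y ∈ A x}

/-- The operator `A + Id`. -/
def addId (A : H → Set H) : H → Set H :=
  fun x => {w | ∃ v ∈ A x, w = v + x}

/-- The operator `A - Id`. -/
def subId (A : H → Set H) : H → Set H :=
  fun x => {w | ∃ v ∈ A x, w = v - x}

/-- The composition `L* ∘ B ∘ L`. -/
def adjointComp (L : H →L[ℝ] G) (B : G → Set G) : H → Set H :=
  fun x => (fun y : G => ContinuousLinearMap.adjoint L y) '' B (L x)

/-- The parallel composition of `B` by `L*`, that is `(L* ∘ B⁻¹ ∘ L)⁻¹`. -/
def parallelComp (L : H →L[ℝ] G) (B : G → Set G) : H → Set H :=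
  opInv (adjointComp L (opInv B))

/-- The resolvent composition `L ▷ B` of the set-valued operator `B` with `L`: the parallel
composition of `B + Id` by `L*`, minus `Id`. -/
def resolventComp (L : H →L[ℝ] G) (B : G → Set G) : H → Set H :=
  subId (parallelComp L (addId B))

end Operators

/-! ### Extended-real-valued functions -/

section Functions

variable {H : Type u} [NormedAddCommGroup H] [InnerProductSpace ℝ H]

/-- `f` is a proper function with values in `]-∞, +∞]`. -/
def IsProper (f : H → EReal) : Prop :=
  (∀ x, f x ≠ ⊥) ∧ ∃ x, f x < ⊤

/-- `f` is convex: its epigraph is a convex subset of `H × ℝ`. -/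
def IsConvex (f : H → EReal) : Prop :=
  Convex ℝ {p : H × ℝ | f p.1 ≤ (p.2 : EReal)}

variable (H) in
/-- The class `Γ₀(H)` of proper lower semicontinuous convex functions from `H` to `]-∞, +∞]`. -/
def Gamma0 : Set (H → EReal) :=
  {f | IsProper f ∧ LowerSemicontinuous f ∧ IsConvex f}

/-- `f` admits a continuous affine minorant. -/
def HasContinuousAffineMinorant (f : H → EReal) : Prop :=
  ∃ a : H →ᴬ[ℝ] ℝ, ∀ x, ((a x : ℝ) : EReal) ≤ f x

/-- The canonical quadratic form `‖·‖² / 2`. -/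
def quad (x : H) : ℝ := ‖x‖ ^ 2 / 2

/-- The (Fenchel) conjugate `f*`. -/
def conjugate (f : H → EReal) : H → EReal :=
  fun u => ⨆ x : H, ((inner ℝ x u : ℝ) : EReal) - f x

/-- The infimal convolution of `f` and `h`; only used where neither function takes the
value `-∞`. -/
def infConv (f h : H → EReal) : H → EReal :=
  fun x => ⨅ z : H, f z + h (x - z)

/-- The subdifferential of `f`. -/
def subdifferential (f : H → EReal) : H → Set H :=
  fun x => {u | ∀ z, ((inner ℝ (z - x) u : ℝ) : EReal) + f x ≤ f z}

/-- `p` is a global minimizer of `z ↦ f z + ‖x - z‖² / 2`. -/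
def IsProxPoint (f : H → EReal) (x p : H) : Prop :=
  ∀ z, f p + ((‖x - p‖ ^ 2 / 2 : ℝ) : EReal) ≤ f z + ((‖x - z‖ ^ 2 / 2 : ℝ) : EReal)

/-- The proximity operator of `f` is well defined: for every `x`, the function
`z ↦ f z + ‖x - z‖² / 2` has exactly one global minimizer. -/
def ProxWellDefined (f : H → EReal) : Prop :=
  ∀ x, ∃! p, IsProxPoint f x p

open Classical in
/-- The proximity operator of `f`, which maps `x` to the unique global minimizer of
`z ↦ f z + ‖x - z‖² / 2` (and, by convention, to `0` if there is no unique one). -/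
def prox (f : H → EReal) : H → H :=
  fun x => if h : ∃! p, IsProxPoint f x p then h.choose else 0

end Functions

/-- The proximal composition `L ▷ g` of the function `g` with `L`, that is
`((g* □ ‖·‖²/2) ∘ L)* - ‖·‖²/2`, where `□` is the infimal convolution. -/
def proximalComp {H : Type u} [NormedAddCommGroup H] [InnerProductSpace ℝ H]
    {G : Type v} [NormedAddCommGroup G] [InnerProductSpace ℝ G]
    (L : H →L[ℝ] G) (g : G → EReal) : H → EReal :=
  fun x =>
    conjugate (fun x' : H => infConv (conjugate g) (fun y => ((quad y : ℝ) : EReal)) (L x')) x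
      - ((quad x : ℝ) : EReal)

end ProximalComposition

end

open ProximalComposition

namespace ProximalComposition

variable {H : Type*} [NormedAddCommGroup H] [InnerProductSpace ℝ H]

/-! Put `h = g**`, `P = prox h`, `Q = ‖·‖²/2`. Then `φ = g* □ Q` is real-valued, equal to `(h +
Q)*`, with gradient `P`; so `ψ = φ ∘ L` has gradient `T = L* ∘ P ∘ L`, and `L ▷ g = ψ* - Q`.
Differentiability enters only through two inequalities: `T x` is a subgradient of `ψ` at `x`, with
error at most `‖y - x‖²`.

Convexity of `ψ* - Q`: it is a supremum of translates of `Q - ψ`, up to constants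
(`conjugate_sub_quad_eq_iSup`), and `Q - ψ = (Q - Q ∘ L) + (Q - φ) ∘ L` is convex because `‖L‖ ≤ 1`
and `Q - φ` is the Moreau envelope of `h`.

Proximity operator: adding `‖x - ·‖²/2` to `ψ* - Q` cancels the quadratic terms, so `p` is a
minimizer exactly when it is a subgradient of `ψ` at `x`, that is `p = T x`. The identity of
operators follows since, for convex `f`, `u ∈ ∂f(x)` means `x = prox f (u + x)`. For `g ∈ Γ₀`,
Fenchel–Moreau gives `g** = g`. -/

omit [NormedAddCommGroup H] [InnerProductSpace ℝ H] in
lemma IsProper.exists_real {f : H → EReal} (hf : IsProper f) {x : H} (hx : f x ≠ ⊤) :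
    ∃ r : ℝ, f x = r :=
  ⟨(f x).toReal, (EReal.coe_toReal hx (hf.1 x)).symm⟩

omit [NormedAddCommGroup H] [InnerProductSpace ℝ H] in
lemma IsProper.exists_point {f : H → EReal} (hf : IsProper f) : ∃ x, ∃ r : ℝ, f x = r :=
  let ⟨x, hx⟩ := hf.2
  ⟨x, hf.exists_real hx.ne⟩

/-! ### Convexity of extended-real-valued functions -/

lemma IsConvex.combo_le {f : H → EReal} (hf : IsConvex f) {x y : H} {a b s t : ℝ}
    (hx : f x ≤ (a : EReal)) (hy : f y ≤ (b : EReal)) (hs : 0 ≤ s) (ht : 0 ≤ t)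
    (hst : s + t = 1) : f (s • x + t • y) ≤ ((s * a + t * b : ℝ) : EReal) :=
  hf (x := (x, a)) hx (y := (y, b)) hy hs ht hst

lemma isConvex_iSup {ι : Sort*} {f : ι → H → EReal} (hf : ∀ i, IsConvex (f i)) :
    IsConvex (fun x => ⨆ i, f i x) := by
  have : {p : H × ℝ | (⨆ i, f i p.1) ≤ (p.2 : EReal)}
      = ⋂ i, {p : H × ℝ | f i p.1 ≤ (p.2 : EReal)} := by
    ext p; simp
  unfold IsConvex
  rw [this]
  exact convex_iInter hf

lemma isConvex_coe {f : H → ℝ} (hf : ConvexOn ℝ Set.univ f) :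
    IsConvex (fun x => (f x : EReal)) := by
  have := hf.convex_epigraph
  simpa [IsConvex] using this

lemma isConvex_const (c : EReal) : IsConvex (fun _ : H => c) := by
  intro p hp q hq s t hs ht hst
  change c ≤ _ at hp hq
  change c ≤ _
  induction c with
  | bot => simp
  | top => simp at hp
  | coe c =>
    simp only [EReal.coe_le_coe_iff, Prod.snd_add, Prod.smul_snd, smul_eq_mul] at *
    calc c = s * c + t * c := by rw [← add_mul, hst, one_mul]
      _ ≤ s * p.2 + t * q.2 := by gcongr

/-- A supremum of real convex continuous functions which is finite somewhere is in `Γ₀`. -/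
lemma iSup_coe_mem_Gamma0 {ι : Type*} [Nonempty ι] {f : ι → H → ℝ}
    (hconv : ∀ i, ConvexOn ℝ Set.univ (f i)) (hcont : ∀ i, Continuous (f i))
    (hfin : ∃ x, (⨆ i, (f i x : EReal)) < ⊤) :
    (fun x => ⨆ i, (f i x : EReal)) ∈ Gamma0 H := by
  refine ⟨⟨fun x hx => ?_, hfin⟩, ?_, isConvex_iSup fun i => isConvex_coe (hconv i)⟩
  · obtain ⟨i⟩ := ‹Nonempty ι›
    have := le_iSup (fun i => (f i x : EReal)) i
    simp only at hx
    rw [hx] at this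
    simp at this
  · exact lowerSemicontinuous_iSup fun i =>
      (continuous_coe_real_ereal.comp (hcont i)).lowerSemicontinuous

/-! ### Conjugates and affine minorants -/

lemma conjugate_le_coe_iff {f : H → EReal} {u : H} {c : ℝ} :
    conjugate f u ≤ c ↔ ∀ x, ((inner ℝ x u - c : ℝ) : EReal) ≤ f x := by
  simp only [conjugate, iSup_le_iff]
  refine forall_congr' fun x => ?_
  induction f x with
  | bot => simp [-EReal.coe_sub]
  | top => simp
  | coe a =>
    rw [← EReal.coe_sub, EReal.coe_le_coe_iff, EReal.coe_le_coe_iff]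
    constructor <;> intro h <;> linarith

lemma le_conjugate_of_le {f : H → EReal} {x u : H} {a : ℝ} (hx : f x ≤ a) :
    ((inner ℝ x u - a : ℝ) : EReal) ≤ conjugate f u := by
  refine le_trans ?_ (le_iSup _ x)
  rw [EReal.coe_sub]
  exact EReal.sub_le_sub le_rfl hx

lemma conjugate_conjugate_le (f : H → EReal) (x : H) : conjugate (conjugate f) x ≤ f x := by
  refine EReal.le_of_forall_lt_iff_le.1 fun a ha => ?_
  rw [conjugate_le_coe_iff]
  intro u
  rw [real_inner_comm]
  exact le_conjugate_of_le ha.le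

lemma conjugate_antitone {f g : H → EReal} (h : ∀ x, f x ≤ g x) (u : H) :
    conjugate g u ≤ conjugate f u :=
  iSup_mono fun x => EReal.sub_le_sub le_rfl (h x)

lemma conjugate_conjugate_conjugate (f : H → EReal) :
    conjugate (conjugate (conjugate f)) = conjugate f :=
  funext fun u => le_antisymm (conjugate_conjugate_le _ u)
    (conjugate_antitone (conjugate_conjugate_le f) u)

lemma isConvex_conjugate (f : H → EReal) : IsConvex (conjugate f) := by
  refine isConvex_iSup fun x => ?_
  induction f x with
  | bot => simpa using isConvex_const (H := H) ⊤
  | top => simpa using isConvex_const (H := H) ⊥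
  | coe a =>
    simp_rw [← EReal.coe_sub]
    refine isConvex_coe ⟨convex_univ, fun p _ q _ s t hs ht hst => le_of_eq ?_⟩
    simp only [inner_add_right, real_inner_smul_right, smul_eq_mul]
    linear_combination a * hst

lemma lowerSemicontinuous_conjugate (f : H → EReal) : LowerSemicontinuous (conjugate f) := by
  refine lowerSemicontinuous_iSup fun x => ?_
  induction f x with
  | bot => simpa using lowerSemicontinuous_const
  | top => simpa using lowerSemicontinuous_const
  | coe a =>
    simp_rw [← EReal.coe_sub]
    exact Continuous.lowerSemicontinuous (continuous_coe_real_ereal.comp (by fun_prop))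

/-- Riesz representation of continuous affine minorants. -/
lemma HasContinuousAffineMinorant.exists_inner [CompleteSpace H] {f : H → EReal}
    (hf : HasContinuousAffineMinorant f) :
    ∃ (u : H) (c : ℝ), ∀ x, ((inner ℝ x u - c : ℝ) : EReal) ≤ f x := by
  obtain ⟨a, ha⟩ := hf
  refine ⟨(InnerProductSpace.toDual ℝ H).symm a.contLinear, -a 0, fun x => ?_⟩
  convert ha x using 2
  rw [real_inner_comm, InnerProductSpace.toDual_symm_apply, sub_neg_eq_add]
  exact (congrFun a.decomp x).symm

lemma conjugate_mem_Gamma0 {f : H → EReal} (hf : IsProper f) {u : H} {c : ℝ}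
    (h : ∀ x, ((inner ℝ x u - c : ℝ) : EReal) ≤ f x) : conjugate f ∈ Gamma0 H := by
  obtain ⟨x, a, hx⟩ := hf.exists_point
  refine ⟨⟨fun v hv => ?_, u, (conjugate_le_coe_iff.2 h).trans_lt (EReal.coe_lt_top c)⟩,
    lowerSemicontinuous_conjugate f, isConvex_conjugate f⟩
  have := le_conjugate_of_le (u := v) hx.le
  rw [hv] at this
  simp [-EReal.coe_sub] at this

lemma IsProper.conjugate_minorant {f : H → EReal} (hf : IsProper f) :
    ∃ (x : H) (a : ℝ), ∀ u, ((inner ℝ u x - a : ℝ) : EReal) ≤ conjugate f u := by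
  obtain ⟨x, a, hx⟩ := hf.exists_point
  refine ⟨x, a, fun u => ?_⟩
  rw [real_inner_comm]
  exact le_conjugate_of_le hx.le

/-! ### Subdifferentials and proximity operators -/

-- Quantifying over real upper bounds `a` of `f z` moves all later estimates from `EReal` to `ℝ`.
omit [InnerProductSpace ℝ H] in
lemma isProxPoint_iff {f : H → EReal} (hf : IsProper f) {x p : H} :
    IsProxPoint f x p ↔ ∃ r : ℝ, f p = r ∧
      ∀ (z : H) (a : ℝ), f z ≤ a → r + ‖x - p‖ ^ 2 / 2 ≤ a + ‖x - z‖ ^ 2 / 2 := by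
  constructor
  · intro h
    obtain ⟨z₀, a₀, h₀⟩ := hf.exists_point
    have hp : f p ≠ ⊤ := by
      intro hp
      have := h z₀
      rw [hp, h₀, EReal.top_add_coe, ← EReal.coe_add] at this
      simp [-EReal.coe_add] at this
    obtain ⟨r, hr⟩ := hf.exists_real hp
    refine ⟨r, hr, fun z a ha => ?_⟩
    have := (h z).trans (add_le_add_left ha _)
    rw [hr] at this
    exact_mod_cast this
  · rintro ⟨r, hr, h⟩ z
    by_cases hz : f z = ⊤
    · rw [hz, EReal.top_add_coe]; exact le_top
    · obtain ⟨a, ha⟩ := hf.exists_real hz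
      rw [hr, ha]
      exact_mod_cast h z a ha.le

lemma mem_subdifferential_iff {f : H → EReal} (hf : IsProper f) {x u : H} :
    u ∈ subdifferential f x ↔ ∃ r : ℝ, f x = r ∧
      ∀ (z : H) (a : ℝ), f z ≤ a → inner ℝ (z - x) u + r ≤ a := by
  constructor
  · intro h
    obtain ⟨z₀, a₀, h₀⟩ := hf.exists_point
    have hp : f x ≠ ⊤ := by
      intro hp
      have := h z₀
      rw [hp, h₀, EReal.coe_add_top] at this
      simp at this
    obtain ⟨r, hr⟩ := hf.exists_real hp
    refine ⟨r, hr, fun z a ha => ?_⟩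
    have := (h z).trans ha
    rw [hr] at this
    exact_mod_cast this
  · rintro ⟨r, hr, h⟩ z
    by_cases hz : f z = ⊤
    · rw [hz]; exact le_top
    · obtain ⟨a, ha⟩ := hf.exists_real hz
      rw [hr, ha]
      exact_mod_cast h z a ha.le

lemma nonpos_of_forall_le_mul {a b : ℝ} (h : ∀ t : ℝ, 0 < t → t ≤ 1 → a ≤ t * b) : a ≤ 0 := by
  by_contra! ha
  have hb : 0 < b := by linarith [h 1 one_pos le_rfl]
  have h1 : a ≤ b := by linarith [h 1 one_pos le_rfl]
  have := h (a / (2 * b)) (by positivity) (by rw [div_le_one (by positivity)]; linarith)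
  have h2 : a / (2 * b) * b = a / 2 := by field_simp
  linarith

lemma norm_sub_sq_half (u d : H) :
    ‖u - d‖ ^ 2 / 2 = ‖u‖ ^ 2 / 2 - inner ℝ d u + ‖d‖ ^ 2 / 2 := by
  rw [norm_sub_sq_real, real_inner_comm]; ring

lemma mem_subdifferential_iff_isProxPoint {f : H → EReal} (hf : IsProper f) (hc : IsConvex f)
    {x u : H} : u ∈ subdifferential f x ↔ IsProxPoint f (u + x) x := by
  rw [mem_subdifferential_iff hf, isProxPoint_iff hf]
  refine exists_congr fun r => and_congr_right fun hr => ?_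
  have key (z : H) : ‖u + x - z‖ ^ 2 / 2 =
      ‖u‖ ^ 2 / 2 - inner ℝ (z - x) u + ‖z - x‖ ^ 2 / 2 := by
    rw [← norm_sub_sq_half, show u - (z - x) = u + x - z by abel]
  constructor
  · intro h z a ha
    have := h z a ha
    rw [key z, add_sub_cancel_right]
    nlinarith [sq_nonneg ‖z - x‖]
  · intro h z a ha
    -- Test minimality at `x + t(z - x)`: the quadratic term is of order `t²`, so it disappears
    -- after dividing by `t` and letting `t → 0`.
    suffices inner ℝ (z - x) u + r - a ≤ 0 by linarith
    refine nonpos_of_forall_le_mul (b := ‖z - x‖ ^ 2 / 2) fun t ht ht1 => ?_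
    have h1 := h _ _ (hc.combo_le hr.le ha (sub_nonneg.2 ht1) ht.le (by ring))
    rw [key ((1 - t) • x + t • z), add_sub_cancel_right,
      show (1 - t) • x + t • z - x = t • (z - x) by module, real_inner_smul_left, norm_smul,
      mul_pow, Real.norm_eq_abs, sq_abs] at h1
    refine le_of_mul_le_mul_left ?_ ht
    linarith

omit [InnerProductSpace ℝ H] in
lemma prox_spec {f : H → EReal} (hf : ProxWellDefined f) (x : H) : IsProxPoint f x (prox f x) := by
  rw [prox, dif_pos (hf x)]
  exact (hf x).choose_spec.1

omit [InnerProductSpace ℝ H] in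
lemma prox_eq_iff {f : H → EReal} (hf : ProxWellDefined f) {x p : H} :
    prox f x = p ↔ IsProxPoint f x p :=
  ⟨fun h => h ▸ prox_spec hf x, fun h => (hf x).unique (prox_spec hf x) h⟩

/-! ### Existence and uniqueness of proximal points -/

lemma norm_sub_midpoint_sq_half (x p q : H) :
    ‖x - ((1 / 2 : ℝ) • p + (1 / 2 : ℝ) • q)‖ ^ 2 / 2 =
      (‖x - p‖ ^ 2 / 2 + ‖x - q‖ ^ 2 / 2) / 2 - ‖p - q‖ ^ 2 / 8 := by
  have h := parallelogram_law_with_norm ℝ (x - p) (x - q)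
  rw [show x - p - (x - q) = -(p - q) by abel, norm_neg,
    show x - p + (x - q) = (2 : ℝ) • (x - ((1 / 2 : ℝ) • p + (1 / 2 : ℝ) • q)) by module,
    norm_smul, Real.norm_two] at h
  linarith

/-- By strong convexity, the midpoint of two distinct minimizers would beat both by `‖p - q‖²/8`. -/
lemma IsProxPoint.unique {f : H → EReal} (hf : IsProper f) (hc : IsConvex f) {x p q : H}
    (hp : IsProxPoint f x p) (hq : IsProxPoint f x q) : p = q := by
  obtain ⟨r, hr, h⟩ := (isProxPoint_iff hf).1 hp
  obtain ⟨s, hs, h'⟩ := (isProxPoint_iff hf).1 hq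
  have h1 := h _ _ (hc.combo_le hr.le hs.le one_half_pos.le one_half_pos.le (add_halves 1))
  have h2 := h' p r hr.le
  rw [norm_sub_midpoint_sq_half] at h1
  rw [← sub_eq_zero, ← norm_eq_zero, ← sq_eq_zero_iff]
  nlinarith [sq_nonneg ‖p - q‖]

/-- The minorant bounds the objective below, strong convexity makes a minimizing sequence Cauchy,
and lower semicontinuity shows that its limit is a minimizer. -/
lemma proxWellDefined_of_minorant [CompleteSpace H] {f : H → EReal} (hf : f ∈ Gamma0 H) {u : H}
    {c : ℝ} (hu : ∀ x, ((inner ℝ x u - c : ℝ) : EReal) ≤ f x) : ProxWellDefined f := by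
  obtain ⟨hp, hlsc, hc⟩ := hf
  intro x
  refine existsUnique_of_exists_of_unique ?_ fun p q => IsProxPoint.unique hp hc
  set S : Set ℝ := {s | ∃ (z : H) (a : ℝ), f z ≤ a ∧ a + ‖x - z‖ ^ 2 / 2 = s} with hS
  have hSne : S.Nonempty :=
    let ⟨z, a, hz⟩ := hp.exists_point
    ⟨_, z, a, hz.le, rfl⟩
  have hSb : BddBelow S := by
    -- Obtained by completing the square: the discarded term is `‖u - (x - z)‖²/2`.
    refine ⟨inner ℝ x u - ‖u‖ ^ 2 / 2 - c, ?_⟩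
    rintro _ ⟨z, a, hz, rfl⟩
    have h1 := EReal.coe_le_coe_iff.1 ((hu z).trans hz)
    have h2 := norm_sub_sq_half u (x - z)
    rw [inner_sub_left] at h2
    nlinarith [sq_nonneg ‖u - (x - z)‖]
  set m := sInf S with hm
  have hmle {z : H} {a : ℝ} (hz : f z ≤ a) : m ≤ a + ‖x - z‖ ^ 2 / 2 :=
    csInf_le hSb ⟨z, a, hz, rfl⟩
  have hseq (n : ℕ) : ∃ (z : H) (a : ℝ), f z ≤ a ∧ a + ‖x - z‖ ^ 2 / 2 < m + 1 / ((n : ℝ) + 1) := by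
    obtain ⟨_, ⟨z, a, hz, rfl⟩, h⟩ := exists_lt_of_csInf_lt hSne
      (lt_add_of_pos_right m (Nat.one_div_pos_of_nat (α := ℝ) (n := n)))
    exact ⟨z, a, hz, h⟩
  choose z a hz ha using hseq
  have hcauchy : CauchySeq z := by
    -- The midpoint of `z n` and `z k` has value at least `m`, which forces `‖z n - z k‖²/8 ≤ 1/(N +
    -- 1)`.
    refine cauchySeq_of_le_tendsto_0 (fun N : ℕ => √(8 * (1 / ((N : ℝ) + 1)))) ?_ ?_
    · intro n k N hn hk
      rw [dist_eq_norm]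
      refine Real.le_sqrt_of_sq_le ?_
      have h1 := hmle (hc.combo_le (hz n) (hz k) one_half_pos.le one_half_pos.le (add_halves 1))
      rw [norm_sub_midpoint_sq_half] at h1
      have h2 := ha n
      have h3 := ha k
      have h4 := Nat.one_div_le_one_div (α := ℝ) hn
      have h5 := Nat.one_div_le_one_div (α := ℝ) hk
      linarith
    · have := (tendsto_one_div_add_atTop_nhds_zero_nat (𝕜 := ℝ)).const_mul 8
      simpa using this.sqrt
  obtain ⟨p, hlim⟩ := cauchySeq_tendsto_of_complete hcauchy
  have hfp : f p ≤ ((m - ‖x - p‖ ^ 2 / 2 : ℝ) : EReal) := by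
    refine EReal.ge_of_forall_gt_iff_ge.1 fun r hr => ?_
    rw [EReal.coe_le_coe_iff]
    have h1 : Filter.Tendsto (fun n : ℕ => m + 1 / ((n : ℝ) + 1) - ‖x - z n‖ ^ 2 / 2)
        Filter.atTop (nhds (m + 0 - ‖x - p‖ ^ 2 / 2)) :=
      (tendsto_one_div_add_atTop_nhds_zero_nat.const_add m).sub
        (((hlim.const_sub x).norm.pow 2).div_const 2)
    rw [add_zero] at h1
    refine ge_of_tendsto h1 ?_
    filter_upwards [hlim.eventually (hlsc p r hr)] with n hn
    have h2 := EReal.coe_lt_coe_iff.1 (hn.trans_le (hz n))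
    linarith [ha n]
  obtain ⟨r, hr⟩ := hp.exists_real (hfp.trans_lt (EReal.coe_lt_top _)).ne
  refine ⟨p, (isProxPoint_iff hp).2 ⟨r, hr, fun w b hw => ?_⟩⟩
  rw [hr, EReal.coe_le_coe_iff] at hfp
  linarith [hmle hw]

/-! ### The Fenchel–Moreau theorem -/

/-- Separation of a point strictly below the graph from the epigraph. -/
lemma Gamma0.exists_separating [CompleteSpace H] {f : H → EReal} (hf : f ∈ Gamma0 H) {x : H}
    {t : ℝ} (ht : (t : EReal) < f x) :
    ∃ (u : H) (β s : ℝ), 0 ≤ β ∧ s < inner ℝ x u - β * t ∧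
      ∀ (z : H) (a : ℝ), f z ≤ a → inner ℝ z u - β * a < s := by
  obtain ⟨hp, hlsc, hc⟩ := hf
  have hclosed : IsClosed {p : H × ℝ | f p.1 ≤ (p.2 : EReal)} :=
    hlsc.isClosed_epigraph.preimage
      (f := fun p : H × ℝ => (p.1, (p.2 : EReal)))
      (continuous_fst.prodMk (continuous_coe_real_ereal.comp continuous_snd))
  obtain ⟨ℓ, s, h1, h2⟩ := geometric_hahn_banach_closed_point (x := (x, t)) hc hclosed
    (fun h => absurd ht (not_lt.2 h))
  have hℓ (z : H) (a : ℝ) : ℓ (z, a) =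
      inner ℝ z ((InnerProductSpace.toDual ℝ H).symm (ℓ.comp (ContinuousLinearMap.inl ℝ H ℝ))) -
        (-ℓ (0, 1)) * a := by
    rw [real_inner_comm, InnerProductSpace.toDual_symm_apply]
    have : ((z, a) : H × ℝ) = (z, 0) + a • ((0 : H), (1 : ℝ)) := by simp
    rw [this, map_add, map_smul]
    simp
    ring
  refine ⟨_, -ℓ (0, 1), s, ?_, by rwa [← hℓ], fun z a hz => ?_⟩
  -- The epigraph is unbounded upwards, so a negative `β` would violate the strict bound by `s`; the
  -- increment in `h3` reaches `s` exactly.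
  · obtain ⟨z, a, hz⟩ := hp.exists_point
    by_contra! hβ
    set β := -ℓ (0, 1) with hβ'
    set c := inner ℝ z ((InnerProductSpace.toDual ℝ H).symm
      (ℓ.comp (ContinuousLinearMap.inl ℝ H ℝ))) with hc'
    have key (d : ℝ) (hd : 0 ≤ d) : c - β * (a + d) < s := by
      rw [hc', hβ', ← hℓ]
      refine h1 (z, a + d) ?_
      change f z ≤ ((a + d : ℝ) : EReal)
      rw [hz, EReal.coe_le_coe_iff]
      linarith
    have h0 := key 0 le_rfl
    have h3 := key ((s - (c - β * a)) / (-β)) (div_nonneg (by linarith) (by linarith))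
    have h4 : β * ((s - (c - β * a)) / (-β)) = -(s - (c - β * a)) := by
      field_simp [hβ.ne]
    linarith
  · rw [← hℓ]
    exact h1 (z, a) hz

/-- A nonvertical separating hyperplane gives an affine minorant. -/
lemma exists_minorant_of_separating {f : H → EReal} {x u : H} {β s t : ℝ} (hp : IsProper f)
    (hβ : 0 < β) (hs : s < inner ℝ x u - β * t)
    (h : ∀ (z : H) (a : ℝ), f z ≤ a → inner ℝ z u - β * a < s) :
    ∃ (v : H) (c : ℝ), (∀ z, ((inner ℝ z v - c : ℝ) : EReal) ≤ f z) ∧ t < inner ℝ x v - c := by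
  refine ⟨β⁻¹ • u, β⁻¹ * s, fun z => ?_, ?_⟩
  · by_cases hz : f z = ⊤
    · rw [hz]; exact le_top
    · obtain ⟨a, ha⟩ := hp.exists_real hz
      rw [ha, EReal.coe_le_coe_iff, real_inner_smul_right, ← mul_sub, inv_mul_le_iff₀ hβ]
      linarith [h z a ha.le]
  · rw [real_inner_smul_right, ← mul_sub, lt_inv_mul_iff₀ hβ]
    linarith

/-- Separating at height `r - 1` below a finite value `r` compares two points on one vertical line,
which forces `β > 0`. -/
lemma Gamma0.exists_minorant [CompleteSpace H] {f : H → EReal} (hf : f ∈ Gamma0 H) :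
    ∃ (u : H) (c : ℝ), ∀ z, ((inner ℝ z u - c : ℝ) : EReal) ≤ f z := by
  obtain ⟨x, r, hx⟩ := hf.1.exists_point
  obtain ⟨u, β, s, hβ, hs, h⟩ := Gamma0.exists_separating hf (x := x) (t := r - 1)
    (by rw [hx, EReal.coe_lt_coe_iff]; linarith)
  have h1 := h x r hx.le
  obtain ⟨v, c, hv, _⟩ := exists_minorant_of_separating hf.1 (by linarith) hs h
  exact ⟨v, c, hv⟩

lemma Gamma0.exists_minorant_gt [CompleteSpace H] {f : H → EReal} (hf : f ∈ Gamma0 H) {x : H}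
    {t : ℝ} (ht : (t : EReal) < f x) :
    ∃ (v : H) (c : ℝ), (∀ z, ((inner ℝ z v - c : ℝ) : EReal) ≤ f z) ∧ t < inner ℝ x v - c := by
  obtain ⟨u, β, s, hβ, hs, h⟩ := Gamma0.exists_separating hf ht
  rcases hβ.eq_or_lt with rfl | hβ
  · obtain ⟨v, c, hv⟩ := Gamma0.exists_minorant hf
    simp only [zero_mul, sub_zero] at hs h
    -- Vertical hyperplane: `⟨·, u⟩ - s` is negative on the domain of `f` and positive at `x`, so a
    -- large multiple of it added to any affine minorant gives another one exceeding `t` at `x`.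
    obtain ⟨n, hn⟩ := exists_nat_gt ((t - (inner ℝ x v - c)) / (inner ℝ x u - s))
    rw [div_lt_iff₀ (sub_pos.2 hs)] at hn
    refine ⟨v + (n : ℝ) • u, c + n * s, fun z => ?_, ?_⟩
    · by_cases hz : f z = ⊤
      · rw [hz]; exact le_top
      · obtain ⟨a, ha⟩ := hf.1.exists_real hz
        have h1 := hv z
        rw [ha, EReal.coe_le_coe_iff] at h1 ⊢
        rw [inner_add_right, real_inner_smul_right]
        nlinarith [mul_le_mul_of_nonneg_left (h z a ha.le).le (Nat.cast_nonneg (α := ℝ) n)]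
    · rw [inner_add_right, real_inner_smul_right]
      linarith
  · exact exists_minorant_of_separating hf.1 hβ hs h

theorem Gamma0.conjugate_conjugate [CompleteSpace H] {f : H → EReal} (hf : f ∈ Gamma0 H) :
    conjugate (conjugate f) = f := by
  refine funext fun x => le_antisymm (conjugate_conjugate_le f x) ?_
  refine EReal.ge_of_forall_gt_iff_ge.1 fun t ht => ?_
  obtain ⟨v, c, hv, hc⟩ := Gamma0.exists_minorant_gt hf ht
  refine le_trans ?_ (le_conjugate_of_le (u := x) (conjugate_le_coe_iff.2 hv))
  rw [EReal.coe_le_coe_iff, real_inner_comm]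
  exact hc.le

/-! ### The function `ψ* - ‖·‖²/2` for a differentiable convex function `ψ` -/

section Smooth

variable {ψ : H → ℝ} {T : H → H}

lemma eq_of_quadratic_upper_bound (hup : ∀ x y, ψ y ≤ ψ x + inner ℝ (y - x) (T x) + ‖y - x‖ ^ 2)
    {x u : H} (hu : ∀ y, ψ x + inner ℝ (y - x) u ≤ ψ y) : u = T x := by
  -- With step `1/2` along `u - T x`, the subgradient inequality gains `‖u - T x‖²/2` over the
  -- linear part, but the upper bound allows only `‖u - T x‖²/4`.
  have h1 := hu (x + (1 / 2 : ℝ) • (u - T x))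
  have h2 := hup x (x + (1 / 2 : ℝ) • (u - T x))
  rw [add_sub_cancel_left, real_inner_smul_left] at h1 h2
  rw [norm_smul, mul_pow, Real.norm_eq_abs, sq_abs] at h2
  have h3 : inner ℝ (u - T x) u - inner ℝ (u - T x) (T x) = ‖u - T x‖ ^ 2 := by
    rw [← inner_sub_right, real_inner_self_eq_norm_sq]
  rw [← sub_eq_zero, ← norm_eq_zero, ← sq_eq_zero_iff]
  nlinarith [sq_nonneg ‖u - T x‖]

lemma continuous_of_quadratic_bounds (hlo : ∀ x y, ψ x + inner ℝ (y - x) (T x) ≤ ψ y)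
    (hup : ∀ x y, ψ y ≤ ψ x + inner ℝ (y - x) (T x) + ‖y - x‖ ^ 2) : Continuous ψ := by
  refine continuous_iff_continuousAt.2 fun x => ?_
  refine tendsto_of_tendsto_of_tendsto_of_le_of_le
    (g := fun y => ψ x + inner ℝ (y - x) (T x))
    (h := fun y => ψ x + inner ℝ (y - x) (T x) + ‖y - x‖ ^ 2) ?_ ?_ (hlo x) (hup x)
  · have : Continuous fun y => ψ x + inner ℝ (y - x) (T x) := by fun_prop
    simpa using this.tendsto x
  · have : Continuous fun y => ψ x + inner ℝ (y - x) (T x) + ‖y - x‖ ^ 2 := by fun_prop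
    simpa using this.tendsto x

lemma conjugate_coe_gradient (hlo : ∀ x y, ψ x + inner ℝ (y - x) (T x) ≤ ψ y) (x : H) :
    conjugate (fun y => (ψ y : EReal)) (T x) = ((inner ℝ x (T x) - ψ x : ℝ) : EReal) := by
  refine le_antisymm (conjugate_le_coe_iff.2 fun y => ?_) (le_conjugate_of_le le_rfl)
  have := hlo x y
  rw [inner_sub_left] at this
  rw [EReal.coe_le_coe_iff]
  linarith

/-- Substituting `x = d + u` turns `⟨x, u⟩ - Q(u)` into `Q(d + u) - Q(d)`, so `u` enters only
through translates of `Q - ψ`. -/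
lemma conjugate_sub_quad_eq_iSup (u : H) :
    conjugate (fun y => (ψ y : EReal)) u - ((quad u : ℝ) : EReal) =
      ⨆ d : H, ((quad (d + u) - ψ (d + u) - quad d : ℝ) : EReal) := by
  have key (d : H) : inner ℝ (d + u) u - ψ (d + u) =
      quad (d + u) - ψ (d + u) - quad d + quad u := by
    simp only [quad]
    rw [norm_add_sq_real, inner_add_left, real_inner_self_eq_norm_sq]
    ring
  refine le_antisymm ?_ (iSup_le fun d => ?_)
  · refine EReal.sub_le_of_le_add (iSup_le fun x => ?_)
    rw [← EReal.coe_sub, ← sub_add_cancel x u, key, EReal.coe_add]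
    exact add_le_add_left
      (le_iSup (fun d => ((quad (d + u) - ψ (d + u) - quad d : ℝ) : EReal)) (x - u)) _
  · rw [show quad (d + u) - ψ (d + u) - quad d = inner ℝ (d + u) u - ψ (d + u) - quad u by
      rw [key]; ring, EReal.coe_sub]
    exact EReal.sub_le_sub (le_conjugate_of_le le_rfl) le_rfl

lemma conjugate_sub_quad_mem_Gamma0 (hlo : ∀ x y, ψ x + inner ℝ (y - x) (T x) ≤ ψ y)
    (hup : ∀ x y, ψ y ≤ ψ x + inner ℝ (y - x) (T x) + ‖y - x‖ ^ 2)
    (hconv : ConvexOn ℝ Set.univ fun x => quad x - ψ x) :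
    (fun u => conjugate (fun y => (ψ y : EReal)) u - ((quad u : ℝ) : EReal)) ∈ Gamma0 H := by
  have hcont := continuous_of_quadratic_bounds hlo hup
  have hfin : conjugate (fun y => (ψ y : EReal)) (T 0) - ((quad (T 0) : ℝ) : EReal) < ⊤ := by
    rw [conjugate_coe_gradient hlo, ← EReal.coe_sub]
    exact EReal.coe_lt_top _
  simp_rw [conjugate_sub_quad_eq_iSup] at hfin ⊢
  refine iSup_coe_mem_Gamma0 (fun d => ?_) (fun d => ?_) ⟨T 0, hfin⟩
  · have := hconv.translate_right d
    rw [Set.preimage_univ] at this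
    exact this.add_const (-quad d)
  · simp only [quad]
    fun_prop

/-- The proximal points of `ψ* - ‖·‖²/2` are given by the gradient of `ψ`. -/
lemma isProxPoint_conjugate_sub_quad_iff (hlo : ∀ x y, ψ x + inner ℝ (y - x) (T x) ≤ ψ y)
    (hup : ∀ x y, ψ y ≤ ψ x + inner ℝ (y - x) (T x) + ‖y - x‖ ^ 2)
    (hk : IsProper fun u => conjugate (fun y => (ψ y : EReal)) u - ((quad u : ℝ) : EReal))
    {x p : H} :
    IsProxPoint (fun u => conjugate (fun y => (ψ y : EReal)) u - ((quad u : ℝ) : EReal)) x p ↔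
      p = T x := by
  have hval {z : H} {a : ℝ} :
      conjugate (fun y => (ψ y : EReal)) z - ((quad z : ℝ) : EReal) ≤ a ↔
        ∀ y, inner ℝ y z - ψ y ≤ a + quad z := by
    rw [EReal.sub_le_iff_le_add (by simp) (by simp), ← EReal.coe_add, conjugate_le_coe_iff]
    refine forall_congr' fun y => ?_
    rw [EReal.coe_le_coe_iff]
    constructor <;> intro h <;> linarith
  have hq (z : H) : ‖x - z‖ ^ 2 / 2 = quad x - inner ℝ x z + quad z := by
    simp only [quad]
    rw [norm_sub_sq_real]; ring
  rw [isProxPoint_iff hk]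
  constructor
  · rintro ⟨r, hr, h⟩
    refine eq_of_quadratic_upper_bound hup fun y => ?_
    have h1 := hval.1 hr.le y
    -- The competitor `T x` has a known value, by equality in Fenchel–Young; the comparison shows
    -- that `p` is a subgradient of `ψ` at `x`.
    have h2 := h (T x) (inner ℝ x (T x) - ψ x - quad (T x)) <| hval.2 fun w => by
      have := hlo x w
      rw [inner_sub_left] at this
      linarith
    rw [hq, hq] at h2
    rw [inner_sub_left]
    linarith
  · rintro rfl
    refine ⟨inner ℝ x (T x) - ψ x - quad (T x), ?_, fun z a ha => ?_⟩
    · rw [conjugate_coe_gradient hlo, ← EReal.coe_sub]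
    · have := hval.1 ha x
      rw [hq, hq]
      linarith

end Smooth

/-! ### The Moreau envelope -/

/-- The value of `g* □ ‖·‖²/2` in terms of a subgradient of `g`. -/
lemma infConv_conjugate_quad {h : H → EReal} (hh : IsProper h) {y p : H} {r : ℝ}
    (hr : h p = r) (hp : y - p ∈ subdifferential h p) :
    infConv (conjugate h) (fun y => ((quad y : ℝ) : EReal)) y =
      ((inner ℝ y p - quad p - r : ℝ) : EReal) := by
  obtain ⟨r', hr', hsub⟩ := (mem_subdifferential_iff hh).1 hp
  obtain rfl : r = r' := EReal.coe_injective (hr.symm.trans hr')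
  refine le_antisymm ?_ (le_iInf fun z => ?_)
  -- The subgradient `y - p` attains the infimum; for other `z`, Fenchel–Young loses at least `‖y -
  -- z - p‖²/2`.
  · refine (iInf_le _ (y - p)).trans ?_
    have h1 : conjugate h (y - p) ≤ ((inner ℝ p (y - p) - r : ℝ) : EReal) := by
      refine conjugate_le_coe_iff.2 fun z => ?_
      by_cases hz : h z = ⊤
      · rw [hz]; exact le_top
      · obtain ⟨a, ha⟩ := hh.exists_real hz
        have := hsub z a ha.le
        rw [inner_sub_left] at this
        rw [ha, EReal.coe_le_coe_iff]
        linarith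
    refine (add_le_add_left h1 _).trans ?_
    rw [sub_sub_cancel, ← EReal.coe_add, EReal.coe_le_coe_iff, inner_sub_right,
      real_inner_self_eq_norm_sq, real_inner_comm]
    simp only [quad]
    linarith
  · refine le_trans ?_ (add_le_add_left (le_conjugate_of_le (u := z) hr.le) _)
    rw [← EReal.coe_add, EReal.coe_le_coe_iff]
    have h2 := norm_sub_sq_half (y - z) p
    rw [inner_sub_right] at h2
    rw [real_inner_comm]
    simp only [quad]
    nlinarith [sq_nonneg ‖y - z - p‖]

/-- `(h + ‖·‖²/2)*` expressed through a selection `P` of proximal points of `h`. -/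
noncomputable def smoothing (h : H → EReal) (P : H → H) (y : H) : ℝ :=
  inner ℝ y (P y) - quad (P y) - (h (P y)).toReal

section Envelope

variable {h : H → EReal} {P : H → H}

/-- `P y` is a competitor in the minimization defining `P y'`. -/
lemma smoothing_lower (hh : IsProper h) (hP : ∀ y, IsProxPoint h y (P y)) (y y' : H) :
    smoothing h P y + inner ℝ (y' - y) (P y) ≤ smoothing h P y' := by
  obtain ⟨r, hr, -⟩ := (isProxPoint_iff hh).1 (hP y)
  obtain ⟨r', hr', h'⟩ := (isProxPoint_iff hh).1 (hP y')
  have := h' (P y) r hr.le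
  rw [norm_sub_sq_real, norm_sub_sq_real] at this
  rw [inner_sub_left]
  simp only [smoothing, hr, hr', EReal.toReal_coe, quad]
  linarith

/-- Monotonicity of the subdifferential: add the subgradient inequalities at `P y` and `P y'`. -/
lemma firmly_nonexpansive (hh : IsProper h) (hc : IsConvex h)
    (hP : ∀ y, IsProxPoint h y (P y)) (y y' : H) :
    ‖P y' - P y‖ ^ 2 ≤ inner ℝ (y' - y) (P y' - P y) := by
  have hs (y : H) : y - P y ∈ subdifferential h (P y) := by
    rw [mem_subdifferential_iff_isProxPoint hh hc, sub_add_cancel]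
    exact hP y
  obtain ⟨r, hr, h1⟩ := (mem_subdifferential_iff hh).1 (hs y)
  obtain ⟨r', hr', h2⟩ := (mem_subdifferential_iff hh).1 (hs y')
  have h3 := h1 _ _ hr'.le
  have h4 := h2 _ _ hr.le
  have h5 : inner ℝ (P y' - P y) (y - P y) + inner ℝ (P y - P y') (y' - P y') =
      ‖P y' - P y‖ ^ 2 - inner ℝ (y' - y) (P y' - P y) := by
    rw [← real_inner_self_eq_norm_sq, real_inner_comm (P y' - P y) (y' - y)]
    simp only [inner_sub_left, inner_sub_right]
    ring
  linarith

/-- Exchanging the points in the lower bound leaves the error `⟨y' - y, P y' - P y⟩`, controlled by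
firm nonexpansiveness and Cauchy–Schwarz. -/
lemma smoothing_upper (hh : IsProper h) (hc : IsConvex h)
    (hP : ∀ y, IsProxPoint h y (P y)) (y y' : H) :
    smoothing h P y' ≤ smoothing h P y + inner ℝ (y' - y) (P y) + ‖y' - y‖ ^ 2 := by
  have h1 := smoothing_lower hh hP y' y
  have h2 := firmly_nonexpansive hh hc hP y y'
  have h3 := real_inner_le_norm (y' - y) (P y' - P y)
  have h4 : inner ℝ (y' - y) (P y' - P y) ≤ ‖y' - y‖ ^ 2 := by
    nlinarith [sq_nonneg (‖y' - y‖ - ‖P y' - P y‖)]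
  rw [← neg_sub y' y, inner_neg_left] at h1
  rw [inner_sub_right] at h4
  linarith

lemma quad_combo (x y : H) {s t : ℝ} (hst : s + t = 1) :
    quad (s • x + t • y) = s * quad x + t * quad y - s * t * quad (x - y) := by
  simp only [quad]
  rw [norm_add_sq_real, norm_sub_sq_real, norm_smul, norm_smul, real_inner_smul_left,
    real_inner_smul_right, mul_pow, mul_pow, Real.norm_eq_abs, Real.norm_eq_abs, sq_abs, sq_abs]
  obtain rfl : t = 1 - s := by linarith
  ring

lemma convexOn_quad : ConvexOn ℝ Set.univ (quad : H → ℝ) := by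
  have := (convexOn_norm (convex_univ (𝕜 := ℝ) (E := H))).pow (fun x _ => norm_nonneg x) 2
  have := this.smul (c := (1 / 2 : ℝ)) (by norm_num)
  refine this.congr fun x _ => ?_
  simp [quad]
  ring

/-- The Moreau envelope `‖·‖²/2 - (h + ‖·‖²/2)*` is convex. -/
lemma convexOn_quad_sub_smoothing (hh : IsProper h) (hc : IsConvex h)
    (hP : ∀ y, IsProxPoint h y (P y)) :
    ConvexOn ℝ Set.univ fun y => quad y - smoothing h P y := by
  have hval (y : H) {r : ℝ} (hr : h (P y) = r) :
      quad y - smoothing h P y = r + quad (y - P y) := by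
    simp only [smoothing, hr, EReal.toReal_coe, quad]
    rw [norm_sub_sq_real]; ring
  refine ⟨convex_univ, fun y _ y' _ s t hs ht hst => ?_⟩
  obtain ⟨r, hr, -⟩ := (isProxPoint_iff hh).1 (hP y)
  obtain ⟨r', hr', -⟩ := (isProxPoint_iff hh).1 (hP y')
  obtain ⟨r'', hr'', h''⟩ := (isProxPoint_iff hh).1 (hP (s • y + t • y'))
  beta_reduce
  rw [hval y hr, hval y' hr', hval _ hr'']
  -- The same convex combination of `P y` and `P y'` is a competitor at `s • y + t • y'`.
  have h1 := h'' _ _ (hc.combo_le hr.le hr'.le hs ht hst)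
  have h2 := convexOn_quad.2 (Set.mem_univ (y - P y)) (Set.mem_univ (y' - P y')) hs ht hst
  rw [show s • (y - P y) + t • (y' - P y') = s • y + t • y' - (s • P y + t • P y') by module] at h2
  simp only [quad, smul_eq_mul] at h1 h2 ⊢
  linarith

end Envelope

/-! ### Proximal compositions -/

section Composition

variable [CompleteSpace H] {G : Type*} [NormedAddCommGroup G] [InnerProductSpace ℝ G]
  [CompleteSpace G]

omit [CompleteSpace H] [CompleteSpace G] in
lemma norm_apply_le_of_norm_le_one {L : H →L[ℝ] G} (hL : ‖L‖ ≤ 1) (x : H) : ‖L x‖ ≤ ‖x‖ :=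
  (L.le_opNorm x).trans (mul_le_of_le_one_left (norm_nonneg x) hL)

omit [CompleteSpace H] [CompleteSpace G] in
-- The convexity defect is `s t (Q(x - y) - Q(L(x - y)))`, nonnegative as `L` is a contraction.
lemma convexOn_quad_sub_quad_comp {L : H →L[ℝ] G} (hL : ‖L‖ ≤ 1) :
    ConvexOn ℝ Set.univ fun x => quad x - quad (L x) := by
  refine ⟨convex_univ, fun x _ y _ s t hs ht hst => ?_⟩
  have h1 : quad (L (x - y)) ≤ quad (x - y) := by
    have := norm_apply_le_of_norm_le_one hL (x - y)
    simp only [quad]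
    gcongr
  have h2 := mul_le_mul_of_nonneg_left h1 (mul_nonneg hs ht)
  rw [map_sub] at h2
  simp only [map_add, map_smul, smul_eq_mul]
  rw [quad_combo x y hst, quad_combo (L x) (L y) hst]
  linarith

omit [CompleteSpace H] [CompleteSpace G] in
/-- Proximal compositions with a function `g` through the proximal points of `g**`. -/
lemma proximalComp_eq {g : G → EReal} (L : H →L[ℝ] G) {P : G → G}
    (hh : IsProper (conjugate (conjugate g)))
    (hP : ∀ y, IsProxPoint (conjugate (conjugate g)) y (P y)) :
    proximalComp L g = fun u =>
      conjugate (fun x => ((smoothing (conjugate (conjugate g)) P (L x) : ℝ) : EReal)) u -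
        ((quad u : ℝ) : EReal) := by
  have key (y : G) : infConv (conjugate g) (fun y => ((quad y : ℝ) : EReal)) y =
      ((smoothing (conjugate (conjugate g)) P y : ℝ) : EReal) := by
    obtain ⟨r, hr, -⟩ := (isProxPoint_iff hh).1 (hP y)
    rw [← conjugate_conjugate_conjugate g, infConv_conjugate_quad hh hr]
    · rw [conjugate_conjugate_conjugate g, smoothing, hr, EReal.toReal_coe]
    · rw [mem_subdifferential_iff_isProxPoint hh (isConvex_conjugate _), sub_add_cancel]
      exact hP y
  funext u
  simp only [proximalComp, key]

lemma proximalComp_mem_Gamma0_and_isProxPoint_iff {g : G → EReal} {L : H →L[ℝ] G} (hL : ‖L‖ ≤ 1)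
    {P : G → G} (hh : IsProper (conjugate (conjugate g)))
    (hP : ∀ y, IsProxPoint (conjugate (conjugate g)) y (P y)) :
    proximalComp L g ∈ Gamma0 H ∧ ∀ x p, IsProxPoint (proximalComp L g) x p ↔
      p = ContinuousLinearMap.adjoint L (P (L x)) := by
  have hc := isConvex_conjugate (conjugate g)
  set φ := smoothing (conjugate (conjugate g)) P with hφ
  have hlo (x y : H) : φ (L x) + inner ℝ (y - x) (ContinuousLinearMap.adjoint L (P (L x))) ≤
      φ (L y) := by
    rw [ContinuousLinearMap.adjoint_inner_right, map_sub]
    exact smoothing_lower hh hP _ _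
  have hup (x y : H) : φ (L y) ≤
      φ (L x) + inner ℝ (y - x) (ContinuousLinearMap.adjoint L (P (L x))) + ‖y - x‖ ^ 2 := by
    have h1 := smoothing_upper hh hc hP (L x) (L y)
    have h2 := norm_apply_le_of_norm_le_one hL (y - x)
    rw [← map_sub] at h1
    rw [ContinuousLinearMap.adjoint_inner_right]
    refine h1.trans ?_
    gcongr
  have hconv : ConvexOn ℝ Set.univ fun x => quad x - φ (L x) := by
    have h1 := (convexOn_quad_sub_smoothing hh hc hP).comp_linearMap L.toLinearMap
    have h2 := (convexOn_quad_sub_quad_comp hL).add h1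
    refine h2.congr fun x _ => ?_
    simp [hφ]
  have hmem := conjugate_sub_quad_mem_Gamma0 (ψ := fun x => φ (L x)) hlo hup hconv
  rw [proximalComp_eq L hh hP]
  exact ⟨hmem, fun x p =>
    isProxPoint_conjugate_sub_quad_iff (ψ := fun x => φ (L x)) hlo hup hmem.1⟩

lemma mem_resolventComp_iff {L : H →L[ℝ] G} {B : G → Set G} {x u : H} :
    u ∈ resolventComp L B x ↔
      ∃ y, L (u + x) - y ∈ B y ∧ x = ContinuousLinearMap.adjoint L y := by
  constructor
  · rintro ⟨v, ⟨y, ⟨w, hw, hy⟩, hx⟩, rfl⟩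
    rw [sub_add_cancel]
    exact ⟨y, by rwa [hy, add_sub_cancel_right], hx.symm⟩
  · rintro ⟨y, hy, hx⟩
    exact ⟨u + x, ⟨y, ⟨_, hy, (sub_add_cancel _ _).symm⟩, hx.symm⟩, (add_sub_cancel_right _ _).symm⟩

theorem proximalComp_properties {g : G → EReal} {L : H →L[ℝ] G} (hL : ‖L‖ ≤ 1)
    (hg : IsProper g) (hm : HasContinuousAffineMinorant g) :
    conjugate g ∈ Gamma0 G ∧
      proximalComp L g ∈ Gamma0 H ∧
      resolventComp L (subdifferential (conjugate (conjugate g))) =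
        subdifferential (proximalComp L g) ∧
      ProxWellDefined (proximalComp L g) ∧
      ProxWellDefined (conjugate (conjugate g)) ∧
      prox (proximalComp L g) =
        (fun x => ContinuousLinearMap.adjoint L (prox (conjugate (conjugate g)) (L x))) := by
  obtain ⟨u, c, huc⟩ := hm.exists_inner
  have h1 := conjugate_mem_Gamma0 hg huc
  obtain ⟨v, d, hvd⟩ := hg.conjugate_minorant
  have h2 := conjugate_mem_Gamma0 h1.1 hvd
  obtain ⟨w, e, hwe⟩ := h1.1.conjugate_minorant
  have hwd := proxWellDefined_of_minorant h2 hwe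
  obtain ⟨hmem, hiff⟩ :=
    proximalComp_mem_Gamma0_and_isProxPoint_iff hL h2.1 (prox_spec hwd)
  have hwd' : ProxWellDefined (proximalComp L g) := fun x =>
    ⟨_, (hiff x _).2 rfl, fun p hp => (hiff x p).1 hp⟩
  refine ⟨h1, hmem, ?_, hwd', hwd, funext fun x => (prox_eq_iff hwd').2 ((hiff x _).2 rfl)⟩
  funext x
  ext u
  rw [mem_subdifferential_iff_isProxPoint hmem.1 hmem.2.2, hiff, mem_resolventComp_iff]
  simp only [mem_subdifferential_iff_isProxPoint h2.1 h2.2.2, sub_add_cancel,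
    ← prox_eq_iff hwd]
  -- The witness `y` in the resolvent composition can only be `prox g** (L (u + x))`.
  exact exists_eq_left'

lemma Gamma0.hasContinuousAffineMinorant {g : G → EReal} (hg : g ∈ Gamma0 G) :
    HasContinuousAffineMinorant g := by
  obtain ⟨u, c, h⟩ := Gamma0.exists_minorant hg
  refine ⟨(innerSL ℝ u).toContinuousAffineMap - ContinuousAffineMap.const ℝ G c, fun x => ?_⟩
  simpa [real_inner_comm] using h x

end Composition

end ProximalComposition

theorem mainTheorem1
    {H : Type*} [NormedAddCommGroup H] [InnerProductSpace ℝ H] [CompleteSpace H]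
    {G : Type*} [NormedAddCommGroup G] [InnerProductSpace ℝ G] [CompleteSpace G]
    (L : H →L[ℝ] G) (hL_pos : 0 < ‖L‖) (hL_le : ‖L‖ ≤ 1) (g : G → EReal) :
    (IsProper g → HasContinuousAffineMinorant g →
      conjugate g ∈ Gamma0 G ∧
      proximalComp L g ∈ Gamma0 H ∧
      resolventComp L (subdifferential (conjugate (conjugate g))) =
        subdifferential (proximalComp L g) ∧
      ProxWellDefined (proximalComp L g) ∧
      ProxWellDefined (conjugate (conjugate g)) ∧
      prox (proximalComp L g) =
        (fun x => ContinuousLinearMap.adjoint L (prox (conjugate (conjugate g)) (L x)))) ∧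
    (g ∈ Gamma0 G →
      resolventComp L (subdifferential g) = subdifferential (proximalComp L g) ∧
      ProxWellDefined (proximalComp L g) ∧
      ProxWellDefined g ∧
      prox (proximalComp L g) = (fun x => ContinuousLinearMap.adjoint L (prox g (L x)))) := by
  refine ⟨fun hg hm => proximalComp_properties hL_le hg hm, fun hg => ?_⟩
  have h := proximalComp_properties hL_le hg.1 (Gamma0.hasContinuousAffineMinorant hg)
  rw [Gamma0.conjugate_conjugate hg] at h
  exact h.2.2
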